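/- A state of the box-ball system is an integer matrix $M=\begin{pmatrix}\alpha_1&\alpha_3&\cdots&\alpha_{2n-1}\\ \alpha_2&\alpha_4&\cdots&\alpha_{2n}\end{pmatrix}$ with $n\ge 0$ and $\alpha_1<\alpha_2<\cdots<\alpha_{2n}$ (the balls occupy the boxes between the walls $\alpha_{2k-1}$ and $\alpha_{2k}$, $1\le k\le n$). Its energy is $E_{\rm CTM}(M)=\sum_{k=1}^n\alpha_{2k-1}$. Its soliton content $\xi(M)$ is the partition obtained as follows. Put $M_1=M$. As long as $M_i$, with entries $\alpha^i_1<\cdots<\alpha^i_{2n_i}$, is not empty, let $h_i=\min_{1\le k\le 2n_i-1}(\alpha^i_{k+1}-\alpha^i_k)$ and $\beta^i_k=\alpha^i_k-kh_i$; remove pairs of equal integers from $\beta^i_1,\dots,\beta^i_{2n_i}$ until there is no such pair, let $v_i$ be the number of removed pairs, and let $M_{i+1}$ be the matrix whose entries are the remaining integers in increasing order. Then $\xi(M)$ is the partition which has, for each $i$, $v_i$ parts equal to $h_1+\cdots+h_i$. Let $L\ge 0$ be an integer and $\lambda=(1^{m_1}2^{m_2}\cdots)$ a partition, with $m_i=m_i(\lambda)$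 parts equal to $i$ and $|\lambda|=\sum_i i\,m_i$. Put $$p_i(\lambda)=L-2\sum_{j\ge1}\min(i,j)\,m_j,\qquad \phi(\lambda)=\sum_{i,j\ge1}\min(i,j)\,m_im_j .$$ Let $\mathcal H(L,\lambda)$ be the (finite) set of states $M$ with $\xi(M)=\lambda$ and, if $n\ge1$, $0\le\alpha_1$ and $\alpha_{2n}\le L$. Let $\mathcal H^+(L,\lambda)$ be the subset of the highest weight states, those with $2\sum_{k=1}^{j-1}\alpha_{2k}+\alpha_{2j}\le 2\sum_{k=1}^{j}\alpha_{2k-1}$ for $1\le j\le n$ (equivalently, for every $\ell\geq 0$ at most half of the boxes between the walls $0$ and $\ell$ are filled). For integers $n$ and $m$ let $${n\brack m}=\frac{\prod_{k=1}^n(1-q^k)}{\prod_{k=1}^m(1-q^k)\prod_{k=1}^{n-m}(1-q^k)}\ \text{ if } 0\le m\le n,\qquad {n\brack m}=0\ \text{ otherwise}.$$ Theorem. With $q$ an indeterminate, $$\sum_{M\in\mathcal H(L,\lambda)}q^{E_{\rm CTM}(M)}=q^{-|\lambda|+\phi(\lambda)}\prod_{i\ge1}{p_i(\lambda)+m_i(\lambda)+i\brack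 m_i(\lambda)},$$ $$\sum_{M\in\mathcal H^+(L,\lambda)}q^{E_{\rm CTM}(M)}=q^{\phi(\lambda)}\prod_{i\ge1}{p_i(\lambda)+m_i(\lambda)\brack m_i(\lambda)}.$$ Here $\prod_{i\ge1}$ is the common value of the finite products $\prod_{i=1}^N$ over all $N$ not smaller than the largest part of $\lambda$ (over all $N\ge0$ if $\lambda$ is empty). -/

import Mathlib

noncomputable section

namespace BoxBall

/-- A state of the box-ball system with finitely many balls, given by the two-row integer matrix
`(α₁ α₃ ⋯ α₂ₙ₋₁ ; α₂ α₄ ⋯ α₂ₙ)` with `α₁ < α₂ < ⋯ < α₂ₙ` (`n ≥ 0`), recorded as the list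
`[α₁, …, α₂ₙ]`. The filled boxes are those between the walls `α₂ₖ₋₁` and `α₂ₖ`, `1 ≤ k ≤ n`. -/
@[ext]
structure State where
  walls : List ℤ
  increasing : walls.Pairwise (· < ·)
  even_length : Even walls.length

/-- The entry `αₖ`, for `1 ≤ k ≤ 2n` (and `0` outside this range). -/
def State.α (M : State) (k : ℕ) : ℤ := M.walls.getD (k - 1) 0

/-- The number `n` of columns. -/
def State.n (M : State) : ℕ := M.walls.length / 2

/-- The energy `E_CTM(M) = ∑ₖ α₂ₖ₋₁`. -/
def State.energy (M : State) : ℤ := ∑ k ∈ Finset.Icc 1 M.n, M.α (2 * k - 1)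

/-- `h = min (αₖ₊₁ - αₖ)` over `1 ≤ k ≤ 2n - 1` (and `0` for the empty list). -/
def gap (l : List ℤ) : ℕ := ((List.zipWith (fun a b => b - a) l l.tail).min?.getD 0).toNat

/-- The list of the integers `βₖ = αₖ - k h`, `1 ≤ k ≤ 2n`. -/
def shifted (l : List ℤ) : List ℤ := l.mapIdx fun j a => a - ((j : ℤ) + 1) * (gap l : ℤ)

/-- `v`, the number of pairs removed from the `βₖ` when pairs of identical integers are removed
until none is left: an integer of multiplicity `c` loses `⌊c / 2⌋` pairs. -/
def removedPairs (l : List ℤ) : ℕ := ∑ x ∈ (shifted l).toFinset, (shifted l).count x / 2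

/-- The integers that remain after this removal (those of odd multiplicity, once each),
in increasing order. -/
def reduce (l : List ℤ) : List ℤ :=
  ((shifted l).toFinset.filter fun x => Odd ((shifted l).count x)).sort (· ≤ ·)

/-- The soliton content `ξ(M)`, as the multiset of row lengths of a Young diagram. With
`M₁ = M`, `Mᵢ₊₁ = reduce Mᵢ`, `hᵢ = gap Mᵢ`, `vᵢ = removedPairs Mᵢ`, it has `vᵢ` rows of length
`h₁ + ⋯ + hᵢ` for each `i` (below, `i` is counted from `0`). Each step removes at least one pair
and nothing happens once the matrix is empty, so `n` steps suffice. -/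
def State.solitonContent (M : State) : Multiset ℕ :=
  ∑ i ∈ Finset.range M.n,
    Multiset.replicate (removedPairs (reduce^[i] M.walls))
      (∑ j ∈ Finset.range (i + 1), gap (reduce^[j] M.walls))

/-- The set `H(L, λ)` of the states between the walls `0` and `L` with soliton content `λ`. -/
def states (L : ℕ) {s : ℕ} (lam : s.Partition) : Set State :=
  {M | (M.n ≠ 0 → 0 ≤ M.α 1 ∧ M.α (2 * M.n) ≤ L) ∧ M.solitonContent = lam.parts}

/-- The set `H⁺(L, λ)` of the highest weight states in `H(L, λ)`. -/
def highestStates (L : ℕ) {s : ℕ} (lam : s.Partition) : Set State :=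
  {M | M ∈ states L lam ∧ ∀ j ∈ Finset.Icc 1 M.n,
    2 * ∑ k ∈ Finset.Icc 1 (j - 1), M.α (2 * k) + M.α (2 * j) ≤
      2 * ∑ k ∈ Finset.Icc 1 j, M.α (2 * k - 1)}

theorem states_finite (L : ℕ) {s : ℕ} (lam : s.Partition) : (states L lam).Finite := by
  refine Set.Finite.of_injOn (f := fun M : State => M.walls.toFinset)
    (t := ((Finset.Icc (0 : ℤ) L).powerset : Set (Finset ℤ))) ?_ ?_ (Finset.finite_toSet _)
  · intro M hM
    simp only [Finset.coe_powerset, Set.mem_preimage, Set.mem_powerset_iff, Finset.coe_subset]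
    intro x hx
    obtain ⟨i, hi, rfl⟩ := List.getElem_of_mem (List.mem_toFinset.1 hx)
    have hev := M.even_length
    have hinc := List.pairwise_iff_getElem.1 M.increasing
    have hn : 2 * M.n = M.walls.length := Nat.two_mul_div_two_of_even hev
    have hb := hM.1 (by omega)
    have h0 : 0 < M.walls.length := by omega
    have h1 : M.walls.length - 1 < M.walls.length := by omega
    have e0 : M.α 1 = M.walls[0] := by simp [State.α, h0]
    have e1 : M.α (2 * M.n) = M.walls[M.walls.length - 1] := by
      rw [State.α, hn, List.getD_eq_getElem _ _ h1]
    rw [e0, e1] at hb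
    rw [Finset.mem_Icc]
    constructor
    · rcases Nat.eq_zero_or_pos i with rfl | h
      · exact hb.1
      · exact hb.1.trans (hinc 0 i h0 hi h).le
    · rcases Nat.lt_or_ge i (M.walls.length - 1) with h | h
      · exact (hinc i _ hi h1 h).le.trans hb.2
      · have : i = M.walls.length - 1 := by omega
        subst this
        exact hb.2
  · intro M _ N _ h
    have hp : M.walls.Perm N.walls :=
      List.perm_of_nodup_nodup_toFinset_eq (M.increasing.imp fun h => ne_of_lt h)
        (N.increasing.imp fun h => ne_of_lt h) h
    exact State.ext (hp.eq_of_pairwise (fun a b _ _ h1 h2 => absurd h1 (not_lt.2 h2.le))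
      M.increasing N.increasing)

theorem highestStates_finite (L : ℕ) {s : ℕ} (lam : s.Partition) :
    (highestStates L lam).Finite :=
  (states_finite L lam).subset fun _ h => h.1

/-- The multiplicity `mᵢ(λ)` of the part `i` in `λ`. -/
def mult {s : ℕ} (lam : s.Partition) (i : ℕ) : ℕ := lam.parts.count i

/-- `pᵢ(λ) = L - 2 ∑_{j ≥ 1} min(i, j) mⱼ`, an integer of either sign
(all parts of a partition of `s` are at most `s`). -/
def vacancy (L : ℕ) {s : ℕ} (lam : s.Partition) (i : ℕ) : ℤ :=
  (L : ℤ) - 2 * ∑ j ∈ Finset.Icc 1 s, (min i j : ℤ) * (mult lam j : ℤ)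

/-- `φ(λ) = ∑_{i, j ≥ 1} min(i, j) mᵢ mⱼ`. -/
def phi {s : ℕ} (lam : s.Partition) : ℤ :=
  ∑ i ∈ Finset.Icc 1 s, ∑ j ∈ Finset.Icc 1 s, (min i j : ℤ) * (mult lam i : ℤ) * (mult lam j : ℤ)

/-- The indeterminate `q` of the field `ℚ(q)`. -/
def q : RatFunc ℚ := RatFunc.X

/-- The `q`-factorial type product `∏_{k=1}^n (1 - q^k)`. -/
def qProd (n : ℕ) : RatFunc ℚ := ∏ k ∈ Finset.Icc 1 n, (1 - q ^ k)

/-- The `q`-binomial coefficient, equal to `0` unless `0 ≤ m ≤ n`. -/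
def qBinom (n : ℤ) (m : ℕ) : RatFunc ℚ :=
  if (m : ℤ) ≤ n then qProd n.toNat / (qProd m * qProd (n - m).toNat) else 0

end BoxBall

end

namespace BoxBall

/-! A step of the algorithm with shift `h` factors into `h` unit steps `αₖ ↦ αₖ - k`, each followed
by the removal of pairs; the first `h - 1` of them remove nothing, since the list stays strictly
increasing. Hence the multiplicity of the part `i + 1` in the soliton content is the number of pairs
removed by the `i`-th unit step, counted from `0` (`count_solitons`), and a unit step deletes the
first column of the Young diagram (`content_unitStep`).

A unit step is invertible once the removed values are kept: `split` sends a list to the remaining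
list `S` and the multiset `X` of removed values, and `merge` sorts `S + X + X` and adds `k` to the
`k`-th entry. For a list with `2n` entries, the bounds `[a, b]` become `[a - 1, b - 2n]` for both
`S` and `X` (`mem_stateLists_iff_split`), and the energy is `n²` plus the energy of `S` plus the sum
of `X` (`oddSum_eq_split`), because deleting a pair from a sorted list preserves its alternating
sum. As `X` is independent of `S`, it contributes one `q`-binomial (`finsum_multisets`), and
induction on a bound `N` for the parts gives `finsum_stateLists`.

The highest weight condition bounds the number of balls left of each wall. That number is again an
alternating sum, so the condition passes to `S` and otherwise only demands `X ≥ 0`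
(`isHighest_iff_split`). The interval is then `[0, L - 2n]`, with the lower end fixed, and the same
induction gives `finsum_highestLists`. -/

/-! ### Removal of pairs from a list -/

/-- The multiset that contains one integer for each pair of equal entries of `l`. -/
def half (l : List ℤ) : Multiset ℤ :=
  ∑ x ∈ l.toFinset, Multiset.replicate (l.count x / 2) x

/-- The entries of odd multiplicity of `l`, in increasing order. -/
def oddPart (l : List ℤ) : List ℤ :=
  (l.toFinset.filter fun x => Odd (l.count x)).sort (· ≤ ·)

/-- The number of pairs of equal entries of `l`. -/
def pairCount (l : List ℤ) : ℕ := ∑ x ∈ l.toFinset, l.count x / 2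

theorem count_half (l : List ℤ) (x : ℤ) : (half l).count x = l.count x / 2 := by
  simp only [half, Multiset.count_sum', Multiset.count_replicate]
  rw [Finset.sum_ite_eq']
  split_ifs with h
  · rfl
  · rw [List.count_eq_zero.2 (by simpa using h), Nat.zero_div]

theorem card_half (l : List ℤ) : (half l).card = pairCount l := by
  simp [half, pairCount]

theorem oddPart_pairwise (l : List ℤ) : (oddPart l).Pairwise (· < ·) :=
  (Finset.sortedLT_sort _).pairwise

theorem count_oddPart (l : List ℤ) (x : ℤ) : (oddPart l).count x = l.count x % 2 := by
  rw [oddPart, List.Nodup.count (Finset.sort_nodup _ _)]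
  simp only [Finset.mem_sort, Finset.mem_filter, List.mem_toFinset]
  split_ifs with h
  · exact (Nat.odd_iff.1 h.2).symm
  · by_cases hx : x ∈ l
    · have := Nat.even_iff.1 (Nat.not_odd_iff_even.1 fun ho => h ⟨hx, ho⟩)
      omega
    · simp [List.count_eq_zero.2 hx]

theorem coe_eq_oddPart_add (l : List ℤ) :
    (l : Multiset ℤ) = (oddPart l : Multiset ℤ) + half l + half l := by
  ext x
  simp only [Multiset.count_add, Multiset.coe_count, count_half, count_oddPart]
  omega

theorem eq_of_pairwise_le_of_coe_eq {l l' : List ℤ} (h : l.Pairwise (· ≤ ·))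
    (h' : l'.Pairwise (· ≤ ·)) (hc : (l : Multiset ℤ) = l') : l = l' :=
  (Multiset.coe_eq_coe.1 hc).eq_of_pairwise (fun _ _ _ _ h1 h2 => le_antisymm h1 h2) h h'

/-- Uniqueness of the decomposition: parities of multiplicities determine `S`, and then halving
determines `X`. This is what makes `merge` a right inverse of `split`. -/
theorem half_eq_and_oddPart_eq {l S : List ℤ} {X : Multiset ℤ} (hS : S.Pairwise (· < ·))
    (h : (l : Multiset ℤ) = S + X + X) : oddPart l = S ∧ half l = X := by
  have key : ∀ x, l.count x = S.count x + X.count x + X.count x ∧ S.count x ≤ 1 := fun x => by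
    have := congrArg (Multiset.count x) h
    simp only [Multiset.count_add, Multiset.coe_count] at this
    exact ⟨this, List.nodup_iff_count_le_one.1 (hS.imp ne_of_lt) x⟩
  constructor
  · refine eq_of_pairwise_le_of_coe_eq ((oddPart_pairwise l).imp le_of_lt) (hS.imp le_of_lt) ?_
    ext x
    rw [Multiset.coe_count, Multiset.coe_count, count_oddPart]
    have := key x
    omega
  · ext x
    rw [count_half]
    have := key x
    omega

theorem length_eq_oddPart_add (l : List ℤ) :
    l.length = (oddPart l).length + 2 * pairCount l := by
  have := congrArg Multiset.card (coe_eq_oddPart_add l)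
  simp only [Multiset.card_add, Multiset.coe_card, card_half] at this
  omega

theorem oddPart_eq_self {l : List ℤ} (h : l.Pairwise (· < ·)) : oddPart l = l :=
  (half_eq_and_oddPart_eq (X := 0) h (by simp)).1

theorem pairCount_eq_zero {l : List ℤ} (h : l.Pairwise (· < ·)) : pairCount l = 0 := by
  rw [← card_half, (half_eq_and_oddPart_eq (X := 0) h (by simp)).2, Multiset.card_zero]

theorem pairwise_lt_of_pairCount_eq_zero {l : List ℤ} (h : l.Pairwise (· ≤ ·))
    (h0 : pairCount l = 0) : l.Pairwise (· < ·) := by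
  have hX : half l = 0 := Multiset.card_eq_zero.1 ((card_half l).trans h0)
  have := coe_eq_oddPart_add l
  rw [hX, add_zero, add_zero] at this
  rw [eq_of_pairwise_le_of_coe_eq h ((oddPart_pairwise l).imp le_of_lt) this]
  exact oddPart_pairwise l

theorem mem_iff_mem_oddPart_or_half {l : List ℤ} {x : ℤ} :
    x ∈ l ↔ x ∈ oddPart l ∨ x ∈ half l := by
  rw [← Multiset.mem_coe, coe_eq_oddPart_add]
  simp only [Multiset.mem_add, Multiset.mem_coe]
  tauto

/-! ### Alternating sums -/

/-- The two copies of `x` land next to each other, so they cancel and leave all later signs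
unchanged. The function `f` is arbitrary because both the energy (`f = id`) and the ball count
`filled` need it. -/
theorem alternatingSum_map_orderedInsert_twice (f : ℤ → ℤ) (x : ℤ) (l : List ℤ) :
    (((l.orderedInsert (· ≤ ·) x).orderedInsert (· ≤ ·) x).map f).alternatingSum =
      (l.map f).alternatingSum := by
  induction l with
  | nil => simp [List.alternatingSum]
  | cons y t ih =>
    by_cases h : x ≤ y
    · simp [List.orderedInsert_cons, h, List.alternatingSum]
      ring
    · simp only [List.orderedInsert_cons, h, if_false, List.map_cons, List.alternatingSum_cons, ih]

theorem alternatingSum_map_eq (f : ℤ → ℤ) {l S : List ℤ} {X : Multiset ℤ}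
    (hl : l.Pairwise (· ≤ ·)) (hS : S.Pairwise (· ≤ ·)) (h : (l : Multiset ℤ) = S + X + X) :
    (l.map f).alternatingSum = (S.map f).alternatingSum := by
  induction X using Multiset.induction generalizing l with
  | empty => rw [eq_of_pairwise_le_of_coe_eq hl hS (by simpa using h)]
  | cons x X ih =>
    have hs := Multiset.pairwise_sort ((S : Multiset ℤ) + X + X) (· ≤ ·)
    rw [← ih hs (Multiset.sort_eq _ _), ← alternatingSum_map_orderedInsert_twice f x (Multiset.sort _ _)]
    congr 2
    refine eq_of_pairwise_le_of_coe_eq hl ((hs.orderedInsert x _).orderedInsert x _) ?_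
    rw [h, Multiset.coe_eq_coe.2 (List.perm_orderedInsert _ _ _), ← Multiset.cons_coe,
      Multiset.coe_eq_coe.2 (List.perm_orderedInsert _ _ _), ← Multiset.cons_coe,
      Multiset.sort_eq]
    simp

/-- The sum of the entries in odd position. -/
def oddSum : List ℤ → ℤ
  | [] => 0
  | [x] => x
  | x :: _ :: t => x + oddSum t

theorem two_mul_oddSum (l : List ℤ) : 2 * oddSum l = l.sum + l.alternatingSum := by
  induction l using oddSum.induct with
  | case1 => simp [oddSum]
  | case2 x => simp [oddSum]; ring
  | case3 x y t ih =>
    simp only [oddSum, List.sum_cons, List.alternatingSum]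
    linarith

theorem oddSum_eq_oddPart_add {l : List ℤ} (hl : l.Pairwise (· ≤ ·)) :
    oddSum l = oddSum (oddPart l) + (half l).sum := by
  have h1 := alternatingSum_map_eq id hl ((oddPart_pairwise l).imp le_of_lt)
    (coe_eq_oddPart_add l)
  have h2 := congrArg Multiset.sum (coe_eq_oddPart_add l)
  simp only [List.map_id, Multiset.sum_add, Multiset.sum_coe] at h1 h2
  have := two_mul_oddSum l
  have := two_mul_oddSum (oddPart l)
  linarith

/-! ### Adding an arithmetic progression -/

/-- Adds `j d, (j + 1) d, …` to the entries of a list. -/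
def stretch (d : ℤ) : ℤ → List ℤ → List ℤ
  | _, [] => []
  | j, a :: t => (a + j * d) :: stretch d (j + 1) t

@[simp]
theorem length_stretch (d j : ℤ) (l : List ℤ) : (stretch d j l).length = l.length := by
  induction l generalizing j with
  | nil => rfl
  | cons a t ih => simp [stretch, ih]

theorem stretch_stretch (d e j : ℤ) (l : List ℤ) :
    stretch d j (stretch e j l) = stretch (e + d) j l := by
  induction l generalizing j with
  | nil => rfl
  | cons a t ih => simp only [stretch, ih]; congr 1; ring

@[simp]
theorem stretch_zero (j : ℤ) (l : List ℤ) : stretch 0 j l = l := by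
  induction l generalizing j with
  | nil => rfl
  | cons a t ih => simp [stretch, ih]

theorem shifted_eq_stretch (l : List ℤ) : shifted l = stretch (-(gap l)) 1 l := by
  have (h : ℤ) (l : List ℤ) : ∀ i : ℕ,
      (l.mapIdx fun j a => a - (((j + i : ℕ) : ℤ) + 1) * h) = stretch (-h) (i + 1) l := by
    induction l with
    | nil => intro i; rfl
    | cons a t ih =>
      intro i
      have := ih (i + 1)
      rw [List.mapIdx_cons, stretch]
      congr 1
      · push_cast; ring
      · push_cast at this
        rw [← this]
        congr 1
        funext j a
        push_cast; ring
  simpa [shifted] using this (gap l) l 0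

theorem isChain_stretch_le (d j : ℤ) (l : List ℤ) :
    (stretch (-d) j l).Pairwise (· ≤ ·) ↔ l.IsChain fun a b => a + d ≤ b := by
  rw [← List.isChain_iff_pairwise]
  induction l generalizing j with
  | nil => simp [stretch]
  | cons a t ih =>
    cases t with
    | nil => simp [stretch]
    | cons b t =>
      have := ih (j + 1)
      simp only [stretch, List.isChain_cons_cons] at this ⊢
      rw [this]
      refine and_congr_left fun _ => ?_
      constructor <;> intro h <;> linarith

theorem isChain_stretch_lt (d j : ℤ) (l : List ℤ) :
    (stretch (-d) j l).Pairwise (· < ·) ↔ l.IsChain fun a b => a + (d + 1) ≤ b := by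
  rw [← List.isChain_iff_pairwise]
  induction l generalizing j with
  | nil => simp [stretch]
  | cons a t ih =>
    cases t with
    | nil => simp [stretch]
    | cons b t =>
      have := ih (j + 1)
      simp only [stretch, List.isChain_cons_cons] at this ⊢
      rw [this]
      refine and_congr_left fun _ => ?_
      constructor <;> intro h <;> linarith

/-- The odd positions receive `j, j + 2, …, j + 2(n - 1)`. -/
theorem oddSum_stretch_one (j : ℤ) (n : ℕ) (l : List ℤ) (hl : l.length = 2 * n) :
    oddSum (stretch 1 j l) = oddSum l + n ^ 2 + (j - 1) * n := by
  induction n generalizing j l with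
  | zero => simp [List.length_eq_zero_iff.1 hl, stretch, oddSum]
  | succ n ih =>
    match l, hl with
    | x :: y :: t, hl =>
      simp only [List.length_cons] at hl
      simp only [stretch, oddSum]
      rw [ih _ t (by omega)]
      push_cast; ring

/-! ### The unit step and the soliton content -/

/-- The passage from `αₖ` to the `αₖ - k`, with pairs removed. -/
def unitStep (l : List ℤ) : List ℤ := oddPart (stretch (-1) 1 l)

/-- The number of pairs removed by the `i`-th unit step, counted from `0`. -/
def content (l : List ℤ) (i : ℕ) : ℕ := pairCount (stretch (-1) 1 (unitStep^[i] l))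

theorem reduce_eq (l : List ℤ) : reduce l = oddPart (stretch (-(gap l)) 1 l) := by
  rw [← shifted_eq_stretch]; rfl

theorem removedPairs_eq (l : List ℤ) :
    removedPairs l = pairCount (stretch (-(gap l)) 1 l) := by
  rw [← shifted_eq_stretch]; rfl

theorem isChain_iff_forall_zipWith (d : ℤ) (l : List ℤ) :
    (l.IsChain fun a b => a + d ≤ b) ↔
      ∀ x ∈ List.zipWith (fun a b => b - a) l l.tail, d ≤ x := by
  induction l with
  | nil => simp
  | cons a t ih =>
    cases t with
    | nil => simp
    | cons b t =>
      rw [List.isChain_cons_cons, ih]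
      simp only [List.tail_cons, List.zipWith_cons_cons, List.mem_cons, forall_eq_or_imp]
      refine and_congr_left fun _ => ?_
      constructor <;> intro h <;> linarith

theorem gap_spec {l : List ℤ} (hl : l.Pairwise (· < ·)) (h2 : 2 ≤ l.length) :
    1 ≤ gap l ∧ (l.IsChain fun a b => a + (gap l : ℤ) ≤ b) ∧
      ¬ l.IsChain fun a b => a + ((gap l : ℤ) + 1) ≤ b := by
  have h1 : l.IsChain fun a b => a + 1 ≤ b := (List.isChain_iff_pairwise.2 hl).imp fun _ _ h => h
  simp only [isChain_iff_forall_zipWith] at h1 ⊢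
  set D := List.zipWith (fun a b => b - a) l l.tail with hD
  have hne : D ≠ [] := by
    match l, h2 with
    | a :: b :: t, _ => simp [hD]
  obtain ⟨g, hg⟩ := Option.isSome_iff_exists.1 (List.isSome_min?_iff.2 hne)
  have hgap : (gap l : ℤ) = g := by
    have := h1 g (List.min?_mem hg)
    simp only [gap, ← hD, hg, Option.getD_some]
    omega
  have hs := List.min?_eq_some_iff.1 hg
  refine ⟨by have := h1 g hs.1; omega, ?_, ?_⟩
  · rw [hgap]; exact hs.2
  · intro h
    have := h g hs.1
    omega

/-- All differences are at least `gap l`, so after fewer than `gap l` shifts the list is still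
strictly increasing and has no pairs to lose. -/
theorem unitStep_iterate {l : List ℤ} (hl : l.Pairwise (· < ·)) (h2 : 2 ≤ l.length) {t : ℕ}
    (ht : t < gap l) : unitStep^[t] l = stretch (-t) 1 l := by
  induction t with
  | zero => simp
  | succ t ih =>
    rw [Function.iterate_succ_apply', ih (by omega), unitStep, stretch_stretch,
      show -(t : ℤ) + -1 = -((t + 1 : ℕ) : ℤ) by push_cast; ring]
    refine oddPart_eq_self ((isChain_stretch_lt _ _ _).2 ((gap_spec hl h2).2.1.imp fun a b h => ?_))
    omega

theorem content_eq_pairCount {l : List ℤ} (hl : l.Pairwise (· < ·)) (h2 : 2 ≤ l.length) {t : ℕ}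
    (ht : t < gap l) : content l t = pairCount (stretch (-(t + 1 : ℕ)) 1 l) := by
  rw [content, unitStep_iterate hl h2 ht, stretch_stretch]
  congr 2
  push_cast; ring

theorem content_eq_zero {l : List ℤ} (hl : l.Pairwise (· < ·)) (h2 : 2 ≤ l.length) {t : ℕ}
    (ht : t + 1 < gap l) : content l t = 0 := by
  rw [content_eq_pairCount hl h2 (by omega)]
  refine pairCount_eq_zero ((isChain_stretch_lt _ _ _).2 ((gap_spec hl h2).2.1.imp fun a b h => ?_))
  omega

theorem content_gap_sub_one {l : List ℤ} (hl : l.Pairwise (· < ·)) (h2 : 2 ≤ l.length) :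
    content l (gap l - 1) = removedPairs l := by
  have := (gap_spec hl h2).1
  rw [content_eq_pairCount hl h2 (by omega), removedPairs_eq, Nat.sub_add_cancel this]

theorem unitStep_iterate_gap {l : List ℤ} (hl : l.Pairwise (· < ·)) (h2 : 2 ≤ l.length) :
    unitStep^[gap l] l = reduce l := by
  have := (gap_spec hl h2).1
  obtain ⟨g, hg⟩ : ∃ g, gap l = g + 1 := ⟨gap l - 1, by omega⟩
  rw [hg, Function.iterate_succ_apply', unitStep_iterate hl h2 (by omega), unitStep,
    stretch_stretch, reduce_eq, hg]
  congr 2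
  push_cast; ring

theorem content_gap_add {l : List ℤ} (hl : l.Pairwise (· < ·)) (h2 : 2 ≤ l.length) (i : ℕ) :
    content l (i + gap l) = content (reduce l) i := by
  rw [content, Function.iterate_add_apply, unitStep_iterate_gap hl h2, content]

/-- The minimal difference is attained, so the shifted list is weakly but not strictly increasing.
This is why `n` steps exhaust the list. -/
theorem removedPairs_pos {l : List ℤ} (hl : l.Pairwise (· < ·)) (h2 : 2 ≤ l.length) :
    0 < removedPairs l := by
  obtain ⟨-, h, h'⟩ := gap_spec hl h2
  rw [Nat.pos_iff_ne_zero, removedPairs_eq]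
  exact fun h0 => h' ((isChain_stretch_lt _ 1 _).1
    (pairwise_lt_of_pairCount_eq_zero ((isChain_stretch_le _ 1 _).2 h) h0))

theorem length_reduce (l : List ℤ) : (reduce l).length + 2 * removedPairs l = l.length := by
  rw [reduce_eq, removedPairs_eq, ← length_eq_oddPart_add, length_stretch]

theorem reduce_pairwise (l : List ℤ) : (reduce l).Pairwise (· < ·) := by
  rw [reduce_eq]; exact oddPart_pairwise _

theorem reduce_nil : reduce [] = [] := by simp [reduce_eq, stretch, oddPart]

theorem removedPairs_nil : removedPairs [] = 0 := by
  have := length_reduce []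
  simp at this; omega

theorem unitStep_nil : unitStep [] = [] := by simp [stretch, oddPart, unitStep]

theorem content_nil (i : ℕ) : content [] i = 0 := by
  rw [content, Function.iterate_fixed unitStep_nil]
  simp [stretch, pairCount]

/-- The first `n` terms of the sum that defines the soliton content. -/
def solitons (n : ℕ) (l : List ℤ) : Multiset ℕ :=
  ∑ i ∈ Finset.range n, Multiset.replicate (removedPairs (reduce^[i] l))
    (∑ j ∈ Finset.range (i + 1), gap (reduce^[j] l))

/-- Every later partial sum of gaps contains the first gap, so the solitons of the reduced list are
lengthened by `gap l`. -/
theorem solitons_succ (n : ℕ) (l : List ℤ) :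
    solitons (n + 1) l = Multiset.replicate (removedPairs l) (gap l) +
      (solitons n (reduce l)).map (· + gap l) := by
  rw [solitons, Finset.sum_range_succ', add_comm, solitons]
  congr 1
  rw [← Multiset.coe_mapAddMonoidHom, map_sum]
  refine Finset.sum_congr rfl fun i _ => ?_
  rw [Multiset.coe_mapAddMonoidHom, Multiset.map_replicate, Finset.sum_range_succ']
  simp

theorem count_solitons (n : ℕ) {l : List ℤ} (hl : l.Pairwise (· < ·)) (he : Even l.length)
    (hn : l.length ≤ 2 * n) :
    (solitons n l).count 0 = 0 ∧ ∀ i, (solitons n l).count (i + 1) = content l i := by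
  induction n generalizing l with
  | zero =>
    obtain rfl := List.length_eq_zero_iff.1 (Nat.le_zero.1 hn)
    simp [solitons, content_nil]
  | succ n ih =>
    rcases Nat.eq_zero_or_pos l.length with h0 | h0
    · obtain rfl := List.length_eq_zero_iff.1 h0
      have h := ih List.Pairwise.nil (by simp) (by simp)
      rw [solitons_succ, removedPairs_nil, reduce_nil]
      have hg : gap [] = 0 := by simp [gap]
      simpa [hg] using h
    · have h2 : 2 ≤ l.length := by
        obtain ⟨k, hk⟩ := he
        omega
      have hlen := length_reduce l
      have hpos := removedPairs_pos hl h2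
      obtain ⟨h, h'⟩ := ih (reduce_pairwise l) (by rw [Nat.even_iff] at he ⊢; omega) (by omega)
      have hg := (gap_spec hl h2).1
      -- The only part that could be mapped to a value at most `gap l` is `0`, which the induction
      -- hypothesis excludes.
      have hsmall : ∀ k < gap l + 1,
          ((solitons n (reduce l)).map (· + gap l)).count k = 0 := by
        intro k hk
        rw [Multiset.count_eq_zero, Multiset.mem_map]
        rintro ⟨a, ha, rfl⟩
        obtain rfl : a = 0 := by omega
        exact Multiset.count_eq_zero.1 h ha
      rw [solitons_succ]
      constructor
      · rw [Multiset.count_add, hsmall 0 (by omega), Multiset.count_replicate,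
          if_neg (by omega)]
      · intro i
        rw [Multiset.count_add, Multiset.count_replicate]
        rcases lt_trichotomy (i + 1) (gap l) with hi | hi | hi
        · rw [hsmall _ (by omega), if_neg (by omega), content_eq_zero hl h2 hi]
        · rw [hsmall _ (by omega), if_pos hi.symm, ← content_gap_sub_one hl h2, ← hi]
          simp
        · obtain ⟨k, rfl⟩ : ∃ k, i = k + gap l := ⟨i - gap l, by omega⟩
          rw [if_neg (by omega), content_gap_add hl h2, ← h', zero_add,
            show k + gap l + 1 = (k + 1) + gap l by ring,
            Multiset.count_map_eq_count' (· + gap l) _ (add_left_injective _)]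

theorem eq_nil_of_content_eq_zero {l : List ℤ} (hl : l.Pairwise (· < ·)) (he : Even l.length)
    (h : ∀ i, content l i = 0) : l = [] := by
  by_contra hne
  have h2 : 2 ≤ l.length := by
    have := List.length_pos_iff.2 hne
    obtain ⟨k, hk⟩ := he
    omega
  have := removedPairs_pos hl h2
  rw [← content_gap_sub_one hl h2, h] at this
  exact this.ne rfl

theorem content_unitStep (l : List ℤ) (i : ℕ) : content (unitStep l) i = content l (i + 1) := by
  rw [content, content, Function.iterate_succ_apply]

theorem length_unitStep (l : List ℤ) :
    l.length = (unitStep l).length + 2 * content l 0 := by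
  rw [unitStep, content, Function.iterate_zero_apply, ← length_eq_oddPart_add, length_stretch]

theorem unitStep_pairwise (l : List ℤ) : (unitStep l).Pairwise (· < ·) := oddPart_pairwise _

theorem even_length_unitStep {l : List ℤ} (he : Even l.length) : Even (unitStep l).length := by
  have := length_unitStep l
  rw [Nat.even_iff] at he ⊢
  omega

theorem length_eq_two_mul_sum_content {l : List ℤ} (hl : l.Pairwise (· < ·))
    (he : Even l.length) {N : ℕ} (h : ∀ i, N ≤ i → content l i = 0) :
    l.length = 2 * ∑ i ∈ Finset.range N, content l i := by
  induction N generalizing l with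
  | zero => simp [eq_nil_of_content_eq_zero hl he fun i => h i (Nat.zero_le i)]
  | succ N ih =>
    rw [length_unitStep, ih (unitStep_pairwise l) (even_length_unitStep he)
      fun i hi => by rw [content_unitStep]; exact h _ (by omega), Finset.sum_range_succ']
    simp only [content_unitStep]
    ring

/-! ### Bounds on the entries -/

theorem forall_le_cons_iff {a x : ℤ} {t : List ℤ} (h : (x :: t).Pairwise (· ≤ ·)) :
    (∀ y ∈ x :: t, a ≤ y) ↔ a ≤ x := by
  rw [List.pairwise_cons] at h
  rw [List.forall_mem_cons]
  exact and_iff_left_of_imp fun ha y hy => ha.trans (h.1 y hy)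

theorem pairwise_stretch {l : List ℤ} (hl : l.Pairwise (· < ·)) (j : ℤ) :
    (stretch (-1) j l).Pairwise (· ≤ ·) :=
  (isChain_stretch_le 1 j l).2 ((List.isChain_iff_pairwise.2 hl).imp fun _ _ h => h)

/-- Both lists are sorted, so only the first entry matters, and it drops by `1`. -/
theorem forall_le_stretch_iff {l : List ℤ} (hl : l.Pairwise (· < ·)) (a : ℤ) :
    (∀ x ∈ stretch (-1) 1 l, a - 1 ≤ x) ↔ ∀ x ∈ l, a ≤ x := by
  have hs := pairwise_stretch hl 1
  cases l with
  | nil => simp [stretch]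
  | cons x t =>
    rw [stretch] at hs ⊢
    rw [forall_le_cons_iff hs, forall_le_cons_iff (hl.imp le_of_lt)]
    constructor <;> intro h <;> linarith

/-- The largest entry is the last one, and it drops by `j - 1 + l.length`. -/
theorem forall_stretch_le_iff {l : List ℤ} (hl : l.Pairwise (· < ·)) (b j : ℤ) :
    (∀ x ∈ stretch (-1) j l, x ≤ b - (j - 1) - l.length) ↔ ∀ x ∈ l, x ≤ b := by
  induction l generalizing j with
  | nil => simp [stretch]
  | cons x t ih =>
    have hs := pairwise_stretch hl j
    cases t with
    | nil =>
      simp only [stretch, List.forall_mem_singleton, List.length_singleton, Nat.cast_one]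
      constructor <;> intro h <;> linarith
    | cons y t =>
      have := ih (List.pairwise_cons.1 hl).2 (j + 1)
      rw [stretch, List.forall_mem_cons, List.forall_mem_cons (a := x), ← this,
        show b - (j + 1 - 1) - ((y :: t).length : ℤ) = b - (j - 1) - ((x :: y :: t).length : ℤ) by
          push_cast [List.length_cons]; ring,
        and_iff_right_of_imp, and_iff_right_of_imp]
      · intro h
        have h1 := (this.1 (by
          rwa [show b - (j + 1 - 1) - ((y :: t).length : ℤ) =
            b - (j - 1) - ((x :: y :: t).length : ℤ) by push_cast [List.length_cons]; ring]))
            y List.mem_cons_self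
        exact ((List.pairwise_cons.1 hl).1 y List.mem_cons_self).le.trans h1
      · intro h
        rw [stretch, List.pairwise_cons, stretch] at hs
        exact (hs.1 _ List.mem_cons_self).trans (h _ (by rw [stretch]; exact List.mem_cons_self))

/-! ### The bijection -/

/-- The increasing lists of even length with entries in `[a, b]` and given content. -/
def stateLists (a b : ℤ) (m : ℕ → ℕ) : Set (List ℤ) :=
  {l | l.Pairwise (· < ·) ∧ Even l.length ∧ (∀ x ∈ l, a ≤ x ∧ x ≤ b) ∧ ∀ i, content l i = m i}

/-- The multisets of `k` integers in `[a, b]`. -/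
def multisets (a b : ℤ) (k : ℕ) : Set (Multiset ℤ) :=
  {X | X.card = k ∧ ∀ x ∈ X, a ≤ x ∧ x ≤ b}

/-- A state, encoded as the result of the unit step and the integers removed in pairs. -/
def split (l : List ℤ) : List ℤ × Multiset ℤ := (unitStep l, half (stretch (-1) 1 l))

/-- The inverse of `split`. -/
def merge (S : List ℤ) (X : Multiset ℤ) : List ℤ :=
  stretch 1 1 (((S : Multiset ℤ) + X + X).sort (· ≤ ·))

theorem stretch_neg_merge (S : List ℤ) (X : Multiset ℤ) :
    stretch (-1) 1 (merge S X) = ((S : Multiset ℤ) + X + X).sort (· ≤ ·) := by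
  rw [merge, stretch_stretch, add_neg_cancel, stretch_zero]

theorem merge_pairwise (S : List ℤ) (X : Multiset ℤ) : (merge S X).Pairwise (· < ·) := by
  have h : (stretch (-1) 1 (merge S X)).Pairwise (· ≤ ·) := by
    rw [stretch_neg_merge]; exact Multiset.pairwise_sort _ _
  exact List.isChain_iff_pairwise.1 (((isChain_stretch_le 1 1 _).1 h).imp fun _ _ h => h)

theorem length_merge (S : List ℤ) (X : Multiset ℤ) :
    (merge S X).length = S.length + 2 * X.card := by
  rw [merge, length_stretch, Multiset.length_sort]
  simp only [Multiset.card_add, Multiset.coe_card]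
  ring

theorem split_merge {S : List ℤ} (hS : S.Pairwise (· < ·)) (X : Multiset ℤ) :
    split (merge S X) = (S, X) := by
  have := half_eq_and_oddPart_eq (l := stretch (-1) 1 (merge S X)) (X := X) hS
    (by rw [stretch_neg_merge, Multiset.sort_eq])
  rw [split, unitStep, this.1, this.2]

theorem merge_split {l : List ℤ} (hl : l.Pairwise (· < ·)) :
    merge (split l).1 (split l).2 = l := by
  have : ((split l).1 + (split l).2 + (split l).2 : Multiset ℤ).sort (· ≤ ·) =
      stretch (-1) 1 l :=
    eq_of_pairwise_le_of_coe_eq (Multiset.pairwise_sort _ _) (pairwise_stretch hl 1)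
      (by rw [Multiset.sort_eq]; exact (coe_eq_oddPart_add _).symm)
  rw [merge, this, stretch_stretch, neg_add_cancel, stretch_zero]

theorem oddSum_eq_split {l : List ℤ} (hl : l.Pairwise (· < ·)) {n : ℕ} (hn : l.length = 2 * n) :
    oddSum l = n ^ 2 + oddSum (split l).1 + (split l).2.sum := by
  conv_lhs => rw [← stretch_zero 1 l, ← neg_add_cancel (1 : ℤ), ← stretch_stretch]
  rw [oddSum_stretch_one 1 n _ (by rw [length_stretch, hn]),
    oddSum_eq_oddPart_add (pairwise_stretch hl 1), split, unitStep]
  ring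

theorem mem_stateLists_iff_split {l : List ℤ} (hl : l.Pairwise (· < ·)) (a b : ℤ) {N : ℕ}
    {m : ℕ → ℕ} (hm : ∀ i, N ≤ i → m i = 0) :
    l ∈ stateLists a b m ↔
      (split l).1 ∈ stateLists (a - 1) (b - 2 * ∑ i ∈ Finset.range N, (m i : ℤ))
        (fun i => m (i + 1)) ∧
      (split l).2 ∈ multisets (a - 1) (b - 2 * ∑ i ∈ Finset.range N, (m i : ℤ)) (m 0) := by
  have hev : Even (unitStep l).length ↔ Even l.length := by
    have := length_unitStep l
    rw [Nat.even_iff, Nat.even_iff]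
    omega
  have hcont : (∀ i, content l i = m i) ↔
      (∀ i, content (unitStep l) i = m (i + 1)) ∧ (half (stretch (-1) 1 l)).card = m 0 := by
    simp only [content_unitStep, card_half]
    refine ⟨fun h => ⟨fun i => h _, h 0⟩, fun h i => ?_⟩
    cases i with
    | zero => exact h.2
    | succ i => exact h.1 i
  -- The upper bound moves by the length of `l`, which is known only through the content; hence both
  -- assumptions.
  have hbd (he : Even l.length) (hc : ∀ i, content l i = m i) : (∀ x ∈ l, a ≤ x ∧ x ≤ b) ↔
      ∀ x ∈ stretch (-1) 1 l,
        a - 1 ≤ x ∧ x ≤ b - 2 * ∑ i ∈ Finset.range N, (m i : ℤ) := by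
    have hlen := length_eq_two_mul_sum_content hl he (N := N)
      fun i hi => by rw [hc, hm i hi]
    simp only [hc] at hlen
    have e : b - 2 * ∑ i ∈ Finset.range N, (m i : ℤ) = b - (1 - 1) - (l.length : ℤ) := by
      rw [hlen]; push_cast; ring
    rw [e, forall₂_and, forall₂_and, forall_le_stretch_iff hl, forall_stretch_le_iff hl]
  simp only [stateLists, multisets, split, Set.mem_ofPred_eq, hev, unitStep_pairwise, hl, true_and]
  have hor : (∀ x ∈ stretch (-1) 1 l,
      a - 1 ≤ x ∧ x ≤ b - 2 * ∑ i ∈ Finset.range N, (m i : ℤ)) ↔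
      (∀ x ∈ unitStep l, a - 1 ≤ x ∧ x ≤ b - 2 * ∑ i ∈ Finset.range N, (m i : ℤ)) ∧
      (∀ x ∈ half (stretch (-1) 1 l),
        a - 1 ≤ x ∧ x ≤ b - 2 * ∑ i ∈ Finset.range N, (m i : ℤ)) := by
    simp only [mem_iff_mem_oddPart_or_half (l := stretch (-1) 1 l), or_imp, forall_and, unitStep]
    tauto
  constructor
  · rintro ⟨he, hb, hc⟩
    have h1 := hor.1 ((hbd he hc).1 hb)
    have h2 := hcont.1 hc
    exact ⟨⟨he, h1.1, h2.1⟩, h2.2, h1.2⟩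
  · rintro ⟨⟨he, hb, hc⟩, hc', hb'⟩
    have hc'' := hcont.2 ⟨hc, hc'⟩
    exact ⟨he, (hbd he hc'').2 (hor.2 ⟨hb, hb'⟩), hc''⟩

theorem bijOn_split {A : Set (List ℤ)} {B : Set (List ℤ)} {C : Set (Multiset ℤ)}
    (hA : ∀ l ∈ A, l.Pairwise (· < ·)) (hB : ∀ l ∈ B, l.Pairwise (· < ·))
    (h : ∀ l : List ℤ, l.Pairwise (· < ·) → (l ∈ A ↔ (split l).1 ∈ B ∧ (split l).2 ∈ C)) :
    Set.BijOn split A (B ×ˢ C) := by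
  refine ⟨fun l hl => (h l (hA l hl)).1 hl, fun l hl l' hl' e => ?_, fun p hp => ?_⟩
  · rw [← merge_split (hA l hl), e, merge_split (hA l' hl')]
  · have hs := split_merge (hB _ hp.1) p.2
    exact ⟨merge p.1 p.2, (h _ (merge_pairwise _ _)).2 (by rw [hs]; exact hp), hs⟩

/-! ### Highest weight states -/

/-- At most half of the boxes to the left of each wall are filled, when `s` boxes to the left of
the walls in the list are filled. -/
def IsHighest : ℤ → List ℤ → Prop
  | s, x :: y :: t => 2 * (s + (y - x)) ≤ y ∧ IsHighest (s + (y - x)) t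
  | _, _ => True

/-- After `j` columns the shifted list has lost `j` balls, one per column, while its next right wall
has moved left by `2j + 2`. With the ball lost in the current column, twice the ball count and the
wall drop equally. -/
theorem isHighest_stretch_iff (s j : ℤ) (l : List ℤ) :
    IsHighest s (stretch (-1) (2 * j + 1) l) ↔ IsHighest (s + j) l := by
  match l with
  | [] => simp [stretch, IsHighest]
  | [x] => simp [stretch, IsHighest]
  | x :: y :: t =>
    have := isHighest_stretch_iff (s + (y - x) - 1) (j + 1) t
    rw [stretch, stretch, IsHighest, IsHighest,
      show s + (y + (2 * j + 1 + 1) * -1 - (x + (2 * j + 1) * -1)) = s + (y - x) - 1 by ring,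
      show 2 * j + 1 + 1 + 1 = 2 * (j + 1) + 1 by ring, this,
      show s + (y - x) - 1 + (j + 1) = s + j + (y - x) by ring]
    refine and_congr_left fun _ => ?_
    constructor <;> intro h <;> linarith

/-- The number of filled boxes to the left of the wall `u`. -/
def filled (u : ℤ) (l : List ℤ) : ℤ := (l.map fun x => max (u - x) 0).alternatingSum

theorem filled_eq_zero {u : ℤ} {l : List ℤ} (h : ∀ x ∈ l, u ≤ x) : filled u l = 0 := by
  induction l with
  | nil => simp [filled]
  | cons x t ih =>
    rw [List.forall_mem_cons] at h
    have := ih h.2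
    rw [filled] at this ⊢
    rw [List.map_cons, List.alternatingSum_cons, this, max_eq_right (by linarith [h.1]), sub_zero]

/-- As `u` grows, `2 * filled u l - u` rises only across filled boxes, so it is enough to test it at
the start `c`, where `hs` applies, and at the right walls. In this form the condition depends on `l`
only through alternating sums, and so ignores pairs. -/
theorem isHighest_iff_forall_filled {l : List ℤ} (hl : l.Pairwise (· ≤ ·)) (he : Even l.length)
    {s c : ℤ} (hc : ∀ x ∈ l, c ≤ x) (hs : 2 * s ≤ c) :
    IsHighest s l ↔ ∀ u, c ≤ u → 2 * (s + filled u l) ≤ u := by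
  match l with
  | [] =>
    simp only [IsHighest, filled, List.map_nil, List.alternatingSum_nil, true_iff]
    intro u hu; linarith
  | [x] => simp at he
  | x :: y :: t =>
    simp only [List.pairwise_cons, List.mem_cons, forall_eq_or_imp] at hl hc
    obtain ⟨⟨hxy, hxt⟩, hyt, ht⟩ := hl
    have het : Even t.length := by
      rw [Nat.even_iff] at he ⊢
      simp at he; omega
    have hf : ∀ u, filled u (x :: y :: t) = max (u - x) 0 - max (u - y) 0 + filled u t := by
      intro u; simp only [filled, List.map_cons, List.alternatingSum_cons]; ring
    rw [IsHighest]
    constructor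
    · rintro ⟨h1, h2⟩ u hu
      rw [hf]
      rcases le_total u y with huy | huy
      · rw [filled_eq_zero fun z hz => huy.trans (hyt z hz), max_eq_right (by linarith : u - y ≤ 0)]
        rcases le_total u x with hux | hux
        · rw [max_eq_right (by linarith)]; linarith
        · rw [max_eq_left (by linarith)]; linarith
      · have := (isHighest_iff_forall_filled ht het hyt h1).1 h2 u huy
        rw [max_eq_left (by linarith), max_eq_left (by linarith)]
        linarith
    · intro h
      have hy := h y (by linarith)
      rw [hf, filled_eq_zero hyt, sub_self, max_self, max_eq_left (by linarith)] at hy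
      have h1 : 2 * (s + (y - x)) ≤ y := by linarith
      refine ⟨h1, (isHighest_iff_forall_filled ht het hyt h1).2 fun u hu => ?_⟩
      have := h u (by linarith)
      rw [hf, max_eq_left (by linarith), max_eq_left (by linarith)] at this
      linarith

theorem isHighest_zero_iff {l : List ℤ} (hl : l.Pairwise (· ≤ ·)) (he : Even l.length) :
    IsHighest 0 l ↔ (∀ x ∈ l, 0 ≤ x) ∧ ∀ u, 0 ≤ u → 2 * filled u l ≤ u := by
  have h0 : IsHighest 0 l → ∀ x ∈ l, 0 ≤ x := by
    match l with
    | [] => simp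
    | [x] => simp at he
    | x :: y :: t =>
      intro h
      rw [forall_le_cons_iff hl]
      -- From `2 (y - x) ≤ y` and `x ≤ y` one gets `x ≤ y ≤ 2 x`, so `0 ≤ x`.
      have := (List.pairwise_cons.1 hl).1 y List.mem_cons_self
      have := h.1
      linarith
  constructor
  · intro h
    have := (isHighest_iff_forall_filled hl he (h0 h) (mul_zero 2).le).1 h
    simp only [zero_add] at this
    exact ⟨h0 h, this⟩
  · rintro ⟨h, h'⟩
    refine (isHighest_iff_forall_filled hl he h (mul_zero 2).le).2 ?_
    simpa only [zero_add] using h'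

theorem isHighest_iff_split {l : List ℤ} (hl : l.Pairwise (· < ·)) (he : Even l.length) :
    IsHighest 0 l ↔ IsHighest 0 (split l).1 ∧ ∀ x ∈ (split l).2, 0 ≤ x := by
  have h1 := isHighest_stretch_iff 0 0 l
  have hs := pairwise_stretch hl 1
  have h2 := isHighest_zero_iff hs (by rwa [length_stretch])
  have h3 := isHighest_zero_iff ((unitStep_pairwise l).imp le_of_lt) (even_length_unitStep he)
  have hf : ∀ u, filled u (stretch (-1) 1 l) = filled u (unitStep l) := fun u =>
    alternatingSum_map_eq _ hs ((unitStep_pairwise l).imp le_of_lt) (coe_eq_oddPart_add _)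
  rw [mul_zero, zero_add, zero_add] at h1
  rw [← h1, h2, split, h3]
  simp only [hf, mem_iff_mem_oddPart_or_half (l := stretch (-1) 1 l), or_imp, forall_and, unitStep]
  tauto

/-! ### Generating functions -/

theorem q_ne_zero : q ≠ 0 := RatFunc.X_ne_zero

theorem one_sub_q_pow_ne_zero {k : ℕ} (hk : k ≠ 0) : 1 - q ^ k ≠ 0 := by
  intro h
  have h1 : (algebraMap (Polynomial ℚ) (RatFunc ℚ)) (Polynomial.X ^ k) =
      algebraMap (Polynomial ℚ) (RatFunc ℚ) 1 := by
    rw [map_pow, map_one, RatFunc.algebraMap_X]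
    exact (sub_eq_zero.1 h).symm
  have h2 := congrArg Polynomial.natDegree (RatFunc.algebraMap_injective ℚ h1)
  rw [Polynomial.natDegree_X_pow, Polynomial.natDegree_one] at h2
  exact hk h2

theorem qProd_ne_zero (n : ℕ) : qProd n ≠ 0 :=
  Finset.prod_ne_zero_iff.2 fun k hk => one_sub_q_pow_ne_zero
    (by rw [Finset.mem_Icc] at hk; omega)

theorem qProd_zero : qProd 0 = 1 := by simp [qProd]

theorem qProd_succ (n : ℕ) : qProd (n + 1) = qProd n * (1 - q ^ (n + 1)) :=
  Finset.prod_Icc_succ_top (by omega) _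

theorem qBinom_natCast_add (k m : ℕ) :
    qBinom ((k : ℤ) + m) m = qProd (k + m) / (qProd m * qProd k) := by
  rw [qBinom, if_pos (by omega), add_sub_cancel_right, Int.toNat_natCast,
    ← Nat.cast_add, Int.toNat_natCast]

theorem qBinom_eq_zero {n : ℤ} {m : ℕ} (h : n < m) : qBinom n m = 0 := by
  rw [qBinom, if_neg (by omega)]

theorem qBinom_zero_right {n : ℤ} (h : 0 ≤ n) : qBinom n 0 = 1 := by
  lift n to ℕ using h
  have := qBinom_natCast_add n 0
  rw [Nat.cast_zero, add_zero] at this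
  rw [this, qProd_zero, one_mul, add_zero, div_self (qProd_ne_zero n)]

theorem qBinom_self (m : ℕ) : qBinom ((0 : ℕ) + m) m = 1 := by
  rw [qBinom_natCast_add, qProd_zero, mul_one, zero_add, div_self (qProd_ne_zero m)]

/-- The `q`-Pascal rule matching `multisets_succ`: either the top value `a + k + 1` is absent, or
one copy of it is removed. -/
theorem qBinom_succ_add_succ (k m : ℕ) :
    qBinom ((k + 1 : ℕ) + (m + 1 : ℕ)) (m + 1) =
      qBinom (k + (m + 1 : ℕ)) (m + 1) + q ^ (k + 1) * qBinom ((k + 1 : ℕ) + m) m := by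
  rw [qBinom_natCast_add, qBinom_natCast_add, qBinom_natCast_add,
    show k + 1 + (m + 1) = (k + m + 1) + 1 by ring, show k + (m + 1) = k + m + 1 by ring,
    show k + 1 + m = k + m + 1 by ring, qProd_succ (k + m + 1), qProd_succ m, qProd_succ k]
  have h1 := qProd_ne_zero m
  have h2 := qProd_ne_zero k
  have h3 := one_sub_q_pow_ne_zero (Nat.succ_ne_zero m)
  have h4 := one_sub_q_pow_ne_zero (Nat.succ_ne_zero k)
  simp only [Nat.succ_eq_add_one] at h3 h4
  field_simp
  ring

theorem multisets_finite (a b : ℤ) (k : ℕ) : (multisets a b k).Finite := by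
  refine (((Finset.Icc a b).sym k).finite_toSet.image Sym.toMultiset).subset ?_
  rintro X ⟨hc, hX⟩
  refine ⟨⟨X, hc⟩, ?_, rfl⟩
  exact Finset.mem_coe.2 (Finset.mem_sym_iff.2 fun x hx => Finset.mem_Icc.2 (hX x hx))

theorem multisets_zero (a b : ℤ) : multisets a b 0 = {0} := by
  ext X
  simp only [multisets, Multiset.card_eq_zero, Set.mem_ofPred_eq, Set.mem_singleton_iff]
  exact ⟨fun h => h.1, fun h => ⟨h, by simp [h]⟩⟩

theorem multisets_self (a : ℤ) (k : ℕ) : multisets a a k = {Multiset.replicate k a} := by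
  ext X
  simp only [multisets, Set.mem_ofPred_eq, Set.mem_singleton_iff, Multiset.eq_replicate]
  exact and_congr_right fun _ => forall₂_congr fun x _ => by omega

theorem multisets_succ {a b : ℤ} (hab : a ≤ b) (k : ℕ) :
    multisets a b (k + 1) =
      multisets a (b - 1) (k + 1) ∪ (fun X => b ::ₘ X) '' multisets a b k := by
  ext X
  simp only [multisets, Set.mem_union, Set.mem_image, Set.mem_ofPred_eq]
  constructor
  · rintro ⟨hc, hX⟩
    by_cases hb : b ∈ X
    · obtain ⟨Y, rfl⟩ := Multiset.exists_cons_of_mem hb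
      rw [Multiset.card_cons] at hc
      exact Or.inr ⟨Y, ⟨by omega, fun x hx => hX x (Multiset.mem_cons_of_mem hx)⟩, rfl⟩
    · refine Or.inl ⟨hc, fun x hx => ?_⟩
      have := hX x hx
      have : x ≠ b := fun e => hb (e ▸ hx)
      omega
  · rintro (⟨hc, hX⟩ | ⟨Y, ⟨hc, hY⟩, rfl⟩)
    · exact ⟨hc, fun x hx => by have := hX x hx; omega⟩
    · refine ⟨by rw [Multiset.card_cons, hc], fun x hx => ?_⟩
      rcases Multiset.mem_cons.1 hx with rfl | hx
      · exact ⟨hab, le_rfl⟩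
      · exact hY x hx

theorem finsum_multisets (a : ℤ) (k m : ℕ) :
    ∑ᶠ X ∈ multisets a (a + k) m, q ^ X.sum = q ^ (a * m) * qBinom (k + m) m := by
  induction m generalizing k with
  | zero =>
    rw [multisets_zero, finsum_mem_singleton, qBinom_zero_right (by positivity)]
    simp
  | succ m ihm =>
    induction k with
    | zero =>
      rw [Nat.cast_zero, add_zero, multisets_self, finsum_mem_singleton, Multiset.sum_replicate,
        ← Nat.cast_zero, qBinom_self, mul_one, nsmul_eq_mul, mul_comm]
    | succ k ihk =>
      have hdisj : Disjoint (multisets a (a + (k + 1 : ℕ) - 1) (m + 1))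
          ((fun X => (a + (k + 1 : ℕ)) ::ₘ X) '' multisets a (a + (k + 1 : ℕ)) m) := by
        rw [Set.disjoint_left]
        rintro _ ⟨-, h⟩ ⟨Y, -, rfl⟩
        have := h _ (Multiset.mem_cons_self _ _)
        omega
      rw [multisets_succ (by omega), finsum_mem_union hdisj (multisets_finite _ _ _)
        ((multisets_finite _ _ _).image _),
        finsum_mem_image fun X _ Y _ e => (Multiset.cons_inj_right _).1 e,
        show a + ((k + 1 : ℕ) : ℤ) - 1 = a + k by push_cast; ring, ihk]
      simp only [Multiset.sum_cons, zpow_add₀ q_ne_zero (a + ((k + 1 : ℕ) : ℤ))]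
      rw [← mul_finsum_mem, ihm, qBinom_succ_add_succ, zpow_add₀ q_ne_zero, zpow_natCast,
        Nat.cast_succ m, mul_add_one, zpow_add₀ q_ne_zero]
      ring

theorem increasing_finite (a b : ℤ) :
    {l : List ℤ | l.Pairwise (· < ·) ∧ ∀ x ∈ l, a ≤ x ∧ x ≤ b}.Finite := by
  refine Set.Finite.of_injOn (f := fun l : List ℤ => l.toFinset)
    (t := ((Finset.Icc a b).powerset : Set (Finset ℤ))) ?_ ?_ (Finset.finite_toSet _)
  · rintro l ⟨-, hl⟩
    rw [Finset.mem_coe, Finset.mem_powerset]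
    intro x hx
    exact Finset.mem_Icc.2 (hl x (List.mem_toFinset.1 hx))
  · rintro l ⟨hl, -⟩ l' ⟨hl', -⟩ h
    exact (List.perm_of_nodup_nodup_toFinset_eq (hl.imp ne_of_lt) (hl'.imp ne_of_lt)
      h).eq_of_pairwise (fun a b _ _ h1 h2 => absurd h1 (not_lt.2 h2.le)) hl hl'

theorem stateLists_finite (a b : ℤ) (m : ℕ → ℕ) : (stateLists a b m).Finite :=
  (increasing_finite a b).subset fun _ h => ⟨h.1, h.2.2.1⟩

theorem finsum_mem_prod_mul {α β : Type*} {A : Set α} {B : Set β} (hA : A.Finite)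
    (hB : B.Finite) (f : α → RatFunc ℚ) (g : β → RatFunc ℚ) :
    ∑ᶠ p ∈ A ×ˢ B, f p.1 * g p.2 = (∑ᶠ x ∈ A, f x) * ∑ᶠ y ∈ B, g y := by
  rw [finsum_mem_eq_finite_toFinset_sum _ (hA.prod hB), finsum_mem_eq_finite_toFinset_sum _ hA,
    finsum_mem_eq_finite_toFinset_sum _ hB, Finset.sum_mul_sum, ← Finset.sum_product',
    Set.Finite.toFinset_prod]

theorem finsum_oddSum_of_split {A B : Set (List ℤ)} {C : Set (Multiset ℤ)}
    (h : Set.BijOn split A (B ×ˢ C)) (hB : B.Finite) (hC : C.Finite) {n : ℕ}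
    (hA : ∀ l ∈ A, l.Pairwise (· < ·) ∧ l.length = 2 * n) :
    ∑ᶠ l ∈ A, q ^ oddSum l =
      q ^ ((n : ℤ) ^ 2) * ((∑ᶠ l ∈ B, q ^ oddSum l) * ∑ᶠ X ∈ C, q ^ X.sum) := by
  rw [← finsum_mem_prod_mul hB hC, mul_finsum_mem]
  refine finsum_mem_eq_of_bijOn split h fun l hl => ?_
  rw [oddSum_eq_split (hA l hl).1 (hA l hl).2, zpow_add₀ q_ne_zero, zpow_add₀ q_ne_zero, mul_assoc]

/-! ### The recursion in the number of distinct part sizes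

Here `m i` is the multiplicity of the part `i + 1`, for `i < N`. -/

/-- The number of parts. -/
def size (N : ℕ) (m : ℕ → ℕ) : ℕ := ∑ j ∈ Finset.range N, m j

/-- The sum of the parts. -/
def weight (N : ℕ) (m : ℕ → ℕ) : ℤ := ∑ j ∈ Finset.range N, ((j : ℤ) + 1) * m j

/-- The number of boxes in the first `i + 1` columns of the Young diagram. -/
def colSum (N : ℕ) (m : ℕ → ℕ) (i : ℕ) : ℤ :=
  ∑ j ∈ Finset.range N, min ((i : ℤ) + 1) ((j : ℤ) + 1) * m j

/-- The sum of the squares of the column lengths of the Young diagram. -/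
def quad (N : ℕ) (m : ℕ → ℕ) : ℤ := ∑ i ∈ Finset.range N, m i * colSum N m i

theorem size_succ (N : ℕ) (m : ℕ → ℕ) :
    size (N + 1) m = size N (fun i => m (i + 1)) + m 0 := Finset.sum_range_succ' _ _

theorem weight_succ (N : ℕ) (m : ℕ → ℕ) :
    weight (N + 1) m = size (N + 1) m + weight N (fun i => m (i + 1)) := by
  rw [weight, Finset.sum_range_succ', size_succ, weight, size]
  push_cast
  simp only [add_one_mul, Finset.sum_add_distrib]
  ring

theorem colSum_zero (N : ℕ) (m : ℕ → ℕ) : colSum N m 0 = size N m := by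
  rw [colSum, size, Nat.cast_sum]
  refine Finset.sum_congr rfl fun j _ => ?_
  rw [min_eq_left (by push_cast; omega)]
  simp

/-- The first column has `size` boxes; deleting it leaves the diagram of the shifted multiplicities.
`weight_succ` and `quad_succ` have the same source. -/
theorem colSum_succ (N : ℕ) (m : ℕ → ℕ) (i : ℕ) :
    colSum (N + 1) m (i + 1) = size (N + 1) m + colSum N (fun i => m (i + 1)) i := by
  rw [colSum, Finset.sum_range_succ', size_succ, colSum, size,
    min_eq_right (by push_cast; omega)]
  push_cast
  simp only [min_add_add_right, add_one_mul, Finset.sum_add_distrib]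
  ring

theorem quad_succ (N : ℕ) (m : ℕ → ℕ) :
    quad (N + 1) m = (size (N + 1) m : ℤ) ^ 2 + quad N (fun i => m (i + 1)) := by
  rw [quad, Finset.sum_range_succ', colSum_zero, quad]
  simp only [colSum_succ, mul_add, Finset.sum_add_distrib, ← Finset.sum_mul]
  have : (size (N + 1) m : ℤ) = ∑ i ∈ Finset.range N, (m (i + 1) : ℤ) + m 0 := by
    rw [size_succ, size]; push_cast; rfl
  linear_combination (-(size (N + 1) m : ℤ)) * this

theorem length_of_mem_stateLists {a b : ℤ} {N : ℕ} {m : ℕ → ℕ} (hm : ∀ i, N ≤ i → m i = 0)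
    {l : List ℤ} (hl : l ∈ stateLists a b m) : l.length = 2 * size N m := by
  obtain ⟨h1, h2, -, h3⟩ := hl
  rw [length_eq_two_mul_sum_content h1 h2 (N := N) fun i hi => by rw [h3, hm i hi], size]
  simp only [h3]

theorem stateLists_of_forall_eq_zero {a b : ℤ} {m : ℕ → ℕ} (hm : ∀ i, m i = 0) :
    stateLists a b m = {[]} := by
  ext l
  rw [Set.mem_singleton_iff]
  constructor
  · rintro ⟨h1, h2, -, h3⟩
    exact eq_nil_of_content_eq_zero h1 h2 fun i => by rw [h3, hm]
  · rintro rfl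
    simp [stateLists, content_nil, hm]

/-- Both components of `split` would have entries in an empty interval, so the list would be empty,
against its length `2 * size N m`. -/
theorem stateLists_eq_empty {a b : ℤ} {N : ℕ} {m : ℕ → ℕ} (hm : ∀ i, N ≤ i → m i = 0)
    (h0 : size N m ≠ 0) (hab : b - 2 * size N m < a - 1) : stateLists a b m = ∅ := by
  rw [Set.eq_empty_iff_forall_notMem]
  intro l hl
  have h1 := hl.1
  obtain ⟨hS, hX⟩ := (mem_stateLists_iff_split h1 a b hm).1 hl
  have hlen := length_of_mem_stateLists hm hl
  rw [size, Nat.cast_sum] at hab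
  have hS0 : (split l).1 = [] := List.eq_nil_iff_forall_not_mem.2 fun x hx => by
    have := hS.2.2.1 x hx
    omega
  have hX0 : (split l).2 = 0 := Multiset.eq_zero_iff_forall_notMem.2 fun x hx => by
    have := hX.2 x hx
    omega
  rw [← merge_split h1, length_merge, hS0, hX0] at hlen
  simp at hlen
  exact h0 hlen

/-- The lower end `a` must vary, as each unit step lowers it by `1`. The interval length thus
becomes `L - 2n + 1`, and these extra units accumulate to the summand `i + 1` in the `q`-binomials.
-/
theorem finsum_stateLists (N : ℕ) {m : ℕ → ℕ} (hm : ∀ i, N ≤ i → m i = 0) (a : ℤ) {L : ℤ}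
    (hL : 0 ≤ L) :
    ∑ᶠ l ∈ stateLists a (a + L) m, q ^ oddSum l =
      q ^ (a * size N m - weight N m + quad N m) *
        ∏ i ∈ Finset.range N, qBinom (L - 2 * colSum N m i + m i + (i + 1 : ℕ)) (m i) := by
  induction N generalizing m a L with
  | zero =>
    rw [stateLists_of_forall_eq_zero fun i => hm i (Nat.zero_le i), finsum_mem_singleton]
    simp [oddSum, size, weight, quad]
  | succ N ih =>
    set n := size (N + 1) m with hn
    have hn' : ∑ i ∈ Finset.range (N + 1), (m i : ℤ) = n := by rw [hn, size]; push_cast; rfl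
    rw [Finset.prod_range_succ', colSum_zero, ← hn]
    rcases lt_or_ge (L - 2 * n + 1) 0 with hneg | hpos
    -- Both sides vanish; on the right it is the factor of the part `1`, whose upper index is below
    -- `m 0`, even if `m 0 = 0`.
    · rw [stateLists_eq_empty hm (by omega) (by omega), finsum_mem_empty, qBinom_eq_zero,
        mul_zero, mul_zero]
      push_cast; omega
    · have hm' : ∀ i, N ≤ i → m (i + 1) = 0 := fun i hi => hm _ (by omega)
      have hbij := bijOn_split (A := stateLists a (a + L) m) (fun l hl => hl.1)
        (fun l hl => hl.1) fun l hl => mem_stateLists_iff_split hl a (a + L) hm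
      rw [finsum_oddSum_of_split hbij (stateLists_finite _ _ _) (multisets_finite _ _ _)
        (n := n) fun l hl => ⟨hl.1, length_of_mem_stateLists hm hl⟩, hn',
        show a + L - 2 * (n : ℤ) = a - 1 + (L - 2 * n + 1) by ring, ih hm' (a - 1) hpos]
      obtain ⟨k, hk⟩ := Int.eq_ofNat_of_zero_le hpos
      have hprod : ∀ i ∈ Finset.range N,
          qBinom (L - 2 * n + 1 - 2 * colSum N (fun i => m (i + 1)) i + m (i + 1) + (i + 1 : ℕ))
            (m (i + 1)) =
          qBinom (L - 2 * colSum (N + 1) m (i + 1) + m (i + 1) + (i + 1 + 1 : ℕ))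
            (m (i + 1)) := by
        intro i _
        rw [colSum_succ, ← hn]
        congr 1
        push_cast; ring
      rw [Finset.prod_congr rfl hprod, hk, finsum_multisets, ← hk,
        show L - 2 * (n : ℤ) + 1 + (m 0 : ℤ) = L - 2 * n + m 0 + (0 + 1 : ℕ) by push_cast; ring,
        quad_succ, weight_succ, ← hn,
        show a * (n : ℤ) - (n + weight N fun i => m (i + 1)) +
            ((n : ℤ) ^ 2 + quad N fun i => m (i + 1)) =
          (n : ℤ) ^ 2 + ((a - 1) * size N (fun i => m (i + 1)) - (weight N fun i => m (i + 1)) +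
            quad N fun i => m (i + 1)) + (a - 1) * m 0 by
          have : (n : ℤ) = size N (fun i => m (i + 1)) + m 0 := by
            rw [hn, size_succ]; push_cast; rfl
          linear_combination (a - 1) * this, zpow_add₀ q_ne_zero (_ + _),
        zpow_add₀ q_ne_zero ((n : ℤ) ^ 2)]
      ring

/-- The highest weight states among the lists with entries in `[0, b]` and given content. -/
def highestLists (b : ℤ) (m : ℕ → ℕ) : Set (List ℤ) := {l ∈ stateLists 0 b m | IsHighest 0 l}

theorem mem_highestLists_iff_split {l : List ℤ} (hl : l.Pairwise (· < ·)) (b : ℤ) {N : ℕ}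
    {m : ℕ → ℕ} (hm : ∀ i, N ≤ i → m i = 0) :
    l ∈ highestLists b m ↔
      (split l).1 ∈ highestLists (b - 2 * ∑ i ∈ Finset.range N, (m i : ℤ)) (fun i => m (i + 1)) ∧
      (split l).2 ∈ multisets 0 (b - 2 * ∑ i ∈ Finset.range N, (m i : ℤ)) (m 0) := by
  have hmem := mem_stateLists_iff_split hl 0 b hm
  simp only [highestLists, Set.mem_sep_iff]
  constructor
  · rintro ⟨h, hh⟩
    obtain ⟨⟨h1, h2, h3, h4⟩, h5, h6⟩ := hmem.1 h
    obtain ⟨h7, h8⟩ := (isHighest_iff_split hl h.2.1).1 hh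
    -- The highest weight condition on the remaining list raises its lower bound from `-1` to `0`.
    have h9 := ((isHighest_zero_iff (h1.imp le_of_lt) h2).1 h7).1
    exact ⟨⟨⟨h1, h2, fun x hx => ⟨h9 x hx, (h3 x hx).2⟩, h4⟩, h7⟩, h5,
      fun x hx => ⟨h8 x hx, (h6 x hx).2⟩⟩
  · rintro ⟨⟨⟨h1, h2, h3, h4⟩, h7⟩, h5, h6⟩
    have h := hmem.2 ⟨⟨h1, h2, fun x hx => ⟨by linarith [(h3 x hx).1], (h3 x hx).2⟩, h4⟩, h5,
      fun x hx => ⟨by linarith [(h6 x hx).1], (h6 x hx).2⟩⟩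
    exact ⟨h, (isHighest_iff_split hl h.2.1).2 ⟨h7, fun x hx => (h6 x hx).1⟩⟩

theorem highestLists_eq_empty {b : ℤ} {N : ℕ} {m : ℕ → ℕ} (hm : ∀ i, N ≤ i → m i = 0)
    (h0 : size N m ≠ 0) (hb : b - 2 * size N m < 0) : highestLists b m = ∅ := by
  rw [Set.eq_empty_iff_forall_notMem]
  intro l hl
  have h1 := hl.1.1
  obtain ⟨hS, hX⟩ := (mem_highestLists_iff_split h1 b hm).1 hl
  have hlen := length_of_mem_stateLists hm hl.1
  rw [size, Nat.cast_sum] at hb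
  have hS0 : (split l).1 = [] := List.eq_nil_iff_forall_not_mem.2 fun x hx => by
    have := hS.1.2.2.1 x hx
    omega
  have hX0 : (split l).2 = 0 := Multiset.eq_zero_iff_forall_notMem.2 fun x hx => by
    have := hX.2 x hx
    omega
  rw [← merge_split h1, length_merge, hS0, hX0] at hlen
  simp at hlen
  exact h0 hlen

theorem finsum_highestLists (N : ℕ) {m : ℕ → ℕ} (hm : ∀ i, N ≤ i → m i = 0) {L : ℤ}
    (hL : 0 ≤ L) :
    ∑ᶠ l ∈ highestLists L m, q ^ oddSum l =
      q ^ quad N m * ∏ i ∈ Finset.range N, qBinom (L - 2 * colSum N m i + m i) (m i) := by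
  induction N generalizing m L with
  | zero =>
    have : highestLists L m = {[]} := by
      rw [highestLists, stateLists_of_forall_eq_zero fun i => hm i (Nat.zero_le i)]
      ext l
      exact ⟨fun h => h.1, fun h => ⟨h, by rw [Set.mem_singleton_iff.1 h]; trivial⟩⟩
    rw [this, finsum_mem_singleton]
    simp [oddSum, quad]
  | succ N ih =>
    set n := size (N + 1) m with hn
    have hn' : ∑ i ∈ Finset.range (N + 1), (m i : ℤ) = n := by rw [hn, size]; push_cast; rfl
    rw [Finset.prod_range_succ', colSum_zero, ← hn]
    rcases lt_or_ge (L - 2 * n) 0 with hneg | hpos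
    · rw [highestLists_eq_empty hm (by omega) (by omega), finsum_mem_empty, qBinom_eq_zero,
        mul_zero, mul_zero]
      omega
    · have hm' : ∀ i, N ≤ i → m (i + 1) = 0 := fun i hi => hm _ (by omega)
      have hbij := bijOn_split (A := highestLists L m) (fun l hl => hl.1.1)
        (fun l hl => hl.1.1) fun l hl => mem_highestLists_iff_split hl L hm
      rw [finsum_oddSum_of_split hbij ((stateLists_finite _ _ _).subset fun _ h => h.1)
        (multisets_finite _ _ _) (n := n) fun l hl => ⟨hl.1.1, length_of_mem_stateLists hm hl.1⟩,
        hn', ih hm' hpos]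
      obtain ⟨k, hk⟩ := Int.eq_ofNat_of_zero_le hpos
      have hprod : ∀ i ∈ Finset.range N,
          qBinom (L - 2 * n - 2 * colSum N (fun i => m (i + 1)) i + m (i + 1)) (m (i + 1)) =
          qBinom (L - 2 * colSum (N + 1) m (i + 1) + m (i + 1)) (m (i + 1)) := by
        intro i _
        rw [colSum_succ, ← hn]
        congr 1
        ring
      have hX := finsum_multisets 0 k (m 0)
      rw [zero_add, zero_mul, zpow_zero, one_mul] at hX
      rw [show (k : ℤ) = L - 2 * n from hk.symm] at hX
      rw [Finset.prod_congr rfl hprod, hX, quad_succ, ← hn, zpow_add₀ q_ne_zero]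
      ring

/-! ### Comparison of states and lists -/

theorem State.two_mul_n (M : State) : M.walls.length = 2 * M.n :=
  (Nat.two_mul_div_two_of_even M.even_length).symm

theorem sum_getD_eq_oddSum (n : ℕ) {l : List ℤ} (hl : l.length = 2 * n) :
    ∑ k ∈ Finset.range n, l.getD (2 * k) 0 = oddSum l := by
  induction n generalizing l with
  | zero => simp [List.length_eq_zero_iff.1 hl, oddSum]
  | succ n ih =>
    match l, hl with
    | x :: y :: t, hl =>
      simp only [List.length_cons] at hl
      rw [Finset.sum_range_succ', oddSum, ← ih (l := t) (by omega), add_comm]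
      simp [mul_add]

theorem sum_Icc_one_eq_sum_range {M : Type*} [AddCommMonoid M] (f : ℕ → M) (n : ℕ) :
    ∑ k ∈ Finset.Icc 1 n, f k = ∑ k ∈ Finset.range n, f (k + 1) := by
  rw [Finset.range_eq_Ico, Finset.sum_Ico_add' f 0 n 1]
  rfl

theorem State.energy_eq_oddSum (M : State) : M.energy = oddSum M.walls := by
  rw [State.energy, sum_Icc_one_eq_sum_range, ← sum_getD_eq_oddSum _ M.two_mul_n]
  rfl

theorem isHighest_iff_forall_getD (n : ℕ) (s : ℤ) {l : List ℤ} (hl : l.length = 2 * n) :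
    IsHighest s l ↔ ∀ j < n,
      2 * s + 2 * ∑ k ∈ Finset.range j, l.getD (2 * k + 1) 0 + l.getD (2 * j + 1) 0 ≤
        2 * ∑ k ∈ Finset.range (j + 1), l.getD (2 * k) 0 := by
  induction n generalizing s l with
  | zero => simp [List.length_eq_zero_iff.1 hl, IsHighest]
  | succ n ih =>
    match l, hl with
    | x :: y :: t, hl =>
      simp only [List.length_cons] at hl
      rw [IsHighest, ih _ (l := t) (by omega), Nat.forall_lt_succ_left]
      refine and_congr ?_ (forall₂_congr fun j _ => ?_)
      · simp only [zero_add, Finset.range_zero, Finset.sum_empty, Finset.range_one,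
          Finset.sum_singleton, mul_zero, List.getD_cons_zero, List.getD_cons_succ, add_zero]
        constructor <;> intro h <;> linarith
      · have e1 : ∑ k ∈ Finset.range (j + 1), (x :: y :: t).getD (2 * k + 1) 0 =
            ∑ k ∈ Finset.range j, t.getD (2 * k + 1) 0 + y :=
          Finset.sum_range_succ' (fun k => (x :: y :: t).getD (2 * k + 1) 0) j
        have e2 : ∑ k ∈ Finset.range (j + 1 + 1), (x :: y :: t).getD (2 * k) 0 =
            ∑ k ∈ Finset.range (j + 1), t.getD (2 * k) 0 + x :=
          Finset.sum_range_succ' (fun k => (x :: y :: t).getD (2 * k) 0) (j + 1)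
        have e3 : (x :: y :: t).getD (2 * (j + 1) + 1) 0 = t.getD (2 * j + 1) 0 := rfl
        rw [e1, e2, e3]
        constructor <;> intro h <;> linarith

theorem State.isHighest_iff (M : State) :
    IsHighest 0 M.walls ↔ ∀ j ∈ Finset.Icc 1 M.n,
      2 * ∑ k ∈ Finset.Icc 1 (j - 1), M.α (2 * k) + M.α (2 * j) ≤
        2 * ∑ k ∈ Finset.Icc 1 j, M.α (2 * k - 1) := by
  rw [isHighest_iff_forall_getD _ _ M.two_mul_n]
  have key (j : ℕ) : (2 * (0 : ℤ) + 2 * ∑ k ∈ Finset.range j, M.walls.getD (2 * k + 1) 0 +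
      M.walls.getD (2 * j + 1) 0 ≤ 2 * ∑ k ∈ Finset.range (j + 1), M.walls.getD (2 * k) 0) ↔
      2 * ∑ k ∈ Finset.Icc 1 (j + 1 - 1), M.α (2 * k) + M.α (2 * (j + 1)) ≤
        2 * ∑ k ∈ Finset.Icc 1 (j + 1), M.α (2 * k - 1) := by
    rw [sum_Icc_one_eq_sum_range, sum_Icc_one_eq_sum_range, mul_zero, zero_add]
    rfl
  simp only [key]
  constructor
  · intro h j hj
    rw [Finset.mem_Icc] at hj
    obtain ⟨i, rfl⟩ : ∃ i, j = i + 1 := ⟨j - 1, by omega⟩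
    exact h i (by omega)
  · intro h j hj
    exact h (j + 1) (Finset.mem_Icc.2 (by omega))

theorem State.bounds_iff (M : State) (L : ℕ) :
    (M.n ≠ 0 → 0 ≤ M.α 1 ∧ M.α (2 * M.n) ≤ L) ↔ ∀ x ∈ M.walls, 0 ≤ x ∧ x ≤ (L : ℤ) := by
  have hn := M.two_mul_n
  have hinc := List.pairwise_iff_getElem.1 M.increasing
  have e (h : M.n ≠ 0) : M.α 1 = M.walls[0] ∧ M.α (2 * M.n) = M.walls[2 * M.n - 1] :=
    ⟨List.getD_eq_getElem _ _ _, List.getD_eq_getElem _ _ _⟩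
  constructor
  · intro hb x hx
    obtain ⟨i, hi, rfl⟩ := List.getElem_of_mem hx
    have h0 : M.n ≠ 0 := by omega
    have hb := hb h0
    rw [(e h0).1, (e h0).2] at hb
    constructor
    · rcases Nat.eq_zero_or_pos i with rfl | h
      · exact hb.1
      · exact hb.1.trans (hinc 0 i (by omega) hi h).le
    · rcases Nat.lt_or_ge i (2 * M.n - 1) with h | h
      · exact (hinc i _ hi (by omega) h).le.trans hb.2
      · obtain rfl : i = 2 * M.n - 1 := by omega
        exact hb.2
  · intro h h0
    rw [(e h0).1, (e h0).2]
    exact ⟨(h _ (List.getElem_mem _)).1, (h _ (List.getElem_mem _)).2⟩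

theorem State.mem_states_iff (M : State) (L : ℕ) {s : ℕ} (lam : s.Partition) :
    M ∈ states L lam ↔ M.walls ∈ stateLists 0 L fun i => mult lam (i + 1) := by
  obtain ⟨h0, hc⟩ := count_solitons M.n M.increasing M.even_length M.two_mul_n.le
  have hx : M.solitonContent = lam.parts ↔ ∀ i, content M.walls i = mult lam (i + 1) := by
    simp only [← hc, mult]
    constructor
    · intro h i
      rw [← h]; rfl
    · intro h
      ext i
      cases i with
      | zero =>
        rw [Multiset.count_eq_zero.2 fun h => lt_irrefl 0 (lam.parts_pos h)]
        exact h0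
      | succ i => exact h i
  simp only [states, stateLists, Set.mem_ofPred_eq, M.bounds_iff, hx, M.increasing, M.even_length,
    true_and]

theorem State.mem_highestStates_iff (M : State) (L : ℕ) {s : ℕ} (lam : s.Partition) :
    M ∈ highestStates L lam ↔ M.walls ∈ highestLists L fun i => mult lam (i + 1) :=
  and_congr (M.mem_states_iff L lam) M.isHighest_iff.symm

theorem finsum_energy {A : Set State} {B : Set (List ℤ)} (h : ∀ M : State, M ∈ A ↔ M.walls ∈ B)
    (hB : ∀ l ∈ B, l.Pairwise (· < ·) ∧ Even l.length) :
    ∑ᶠ M ∈ A, q ^ M.energy = ∑ᶠ l ∈ B, q ^ oddSum l := by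
  refine finsum_mem_eq_of_bijOn State.walls ⟨fun M hM => (h M).1 hM, fun M _ M' _ e =>
    State.ext e, fun l hl => ?_⟩ fun M _ => by rw [M.energy_eq_oddSum]
  exact ⟨⟨l, (hB l hl).1, (hB l hl).2⟩, (h _).2 hl, rfl⟩

/-! ### Sums over the parts of a partition -/

theorem mult_eq_zero {s N : ℕ} {lam : s.Partition} (hN : ∀ i ∈ lam.parts, i ≤ N) {i : ℕ}
    (hi : N ≤ i) : mult lam (i + 1) = 0 :=
  Multiset.count_eq_zero.2 fun h => by have := hN _ h; omega

theorem sum_mult_eq {s N : ℕ} (lam : s.Partition) (hN : ∀ i ∈ lam.parts, i ≤ N) (f : ℕ → ℤ) :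
    ∑ j ∈ Finset.range N, f (j + 1) * mult lam (j + 1) =
      ∑ j ∈ lam.parts.toFinset, f j * mult lam j := by
  rw [← sum_Icc_one_eq_sum_range fun j => f j * mult lam j]
  refine (Finset.sum_subset (fun i hi => ?_) fun i _ hi => ?_).symm
  · rw [Multiset.mem_toFinset] at hi
    exact Finset.mem_Icc.2 ⟨lam.parts_pos hi, hN i hi⟩
  · rw [Multiset.mem_toFinset] at hi
    rw [mult, Multiset.count_eq_zero.2 hi, Nat.cast_zero, mul_zero]

/-- Any bound on the parts may replace `s`: both sums reduce to the parts that occur. -/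
theorem sum_Icc_mult_eq {s N : ℕ} (lam : s.Partition) (hN : ∀ i ∈ lam.parts, i ≤ N)
    (f : ℕ → ℤ) :
    ∑ j ∈ Finset.Icc 1 s, f j * mult lam j =
      ∑ j ∈ Finset.range N, f (j + 1) * mult lam (j + 1) := by
  rw [sum_Icc_one_eq_sum_range fun j => f j * mult lam j, sum_mult_eq lam hN,
    sum_mult_eq lam fun i hi => (Multiset.le_sum_of_mem hi).trans_eq lam.parts_sum]

theorem vacancy_succ {s N : ℕ} (L : ℕ) (lam : s.Partition) (hN : ∀ i ∈ lam.parts, i ≤ N)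
    (i : ℕ) : vacancy L lam (i + 1) = L - 2 * colSum N (fun i => mult lam (i + 1)) i := by
  rw [vacancy, sum_Icc_mult_eq lam hN, colSum]
  push_cast
  rfl

theorem phi_eq_quad {s N : ℕ} (lam : s.Partition) (hN : ∀ i ∈ lam.parts, i ≤ N) :
    phi lam = quad N fun i => mult lam (i + 1) := by
  have h (i : ℕ) : ∑ j ∈ Finset.Icc 1 s, (min i j : ℤ) * (mult lam i : ℤ) * (mult lam j : ℤ) =
      (∑ j ∈ Finset.range N, (min (i : ℤ) ((j : ℤ) + 1)) * mult lam (j + 1)) * mult lam i := by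
    rw [sum_Icc_mult_eq lam hN, Finset.sum_mul]
    refine Finset.sum_congr rfl fun j _ => ?_
    push_cast
    ring
  rw [phi, Finset.sum_congr rfl fun i _ => h i, sum_Icc_mult_eq lam hN, quad]
  refine Finset.sum_congr rfl fun i _ => ?_
  rw [mul_comm, colSum]
  push_cast
  rfl

theorem weight_mult {s N : ℕ} (lam : s.Partition) (hN : ∀ i ∈ lam.parts, i ≤ N) :
    weight N (fun i => mult lam (i + 1)) = s := by
  have h := sum_mult_eq lam hN fun i => (i : ℤ)
  push_cast at h
  have h' := congrArg (Nat.cast : ℕ → ℤ) (Finset.sum_multiset_count lam.parts)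
  rw [lam.parts_sum] at h'
  rw [weight, h, h']
  push_cast
  exact Finset.sum_congr rfl fun i _ => by rw [smul_eq_mul, Nat.cast_mul, mul_comm]; rfl

end BoxBall

theorem mainTheorem3 (L s : ℕ) (lam : s.Partition) (N : ℕ) (hN : ∀ i ∈ lam.parts, i ≤ N) :
    (∑ M ∈ (BoxBall.states_finite L lam).toFinset, BoxBall.q ^ M.energy =
      BoxBall.q ^ (-(s : ℤ) + BoxBall.phi lam) *
        ∏ i ∈ Finset.Icc 1 N,
          BoxBall.qBinom (BoxBall.vacancy L lam i + BoxBall.mult lam i + i)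
            (BoxBall.mult lam i)) ∧
    (∑ M ∈ (BoxBall.highestStates_finite L lam).toFinset, BoxBall.q ^ M.energy =
      BoxBall.q ^ BoxBall.phi lam *
        ∏ i ∈ Finset.Icc 1 N,
          BoxBall.qBinom (BoxBall.vacancy L lam i + BoxBall.mult lam i)
            (BoxBall.mult lam i)) := by
  have hm : ∀ i, N ≤ i → BoxBall.mult lam (i + 1) = 0 := fun i hi => BoxBall.mult_eq_zero hN hi
  have hIcc (f : ℕ → RatFunc ℚ) :
      ∏ i ∈ Finset.Icc 1 N, f i = ∏ i ∈ Finset.range N, f (i + 1) := by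
    rw [Finset.range_eq_Ico, Finset.prod_Ico_add' f 0 N 1]
    rfl
  rw [← finsum_mem_eq_finite_toFinset_sum, ← finsum_mem_eq_finite_toFinset_sum, hIcc, hIcc,
    BoxBall.finsum_energy (fun M => M.mem_states_iff L lam) fun l hl => ⟨hl.1, hl.2.1⟩,
    BoxBall.finsum_energy (fun M => M.mem_highestStates_iff L lam)
      fun l hl => ⟨hl.1.1, hl.1.2.1⟩,
    BoxBall.finsum_highestLists N hm (Int.natCast_nonneg L)]
  have h := BoxBall.finsum_stateLists N hm 0 (Int.natCast_nonneg L)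
  rw [zero_add, zero_mul, zero_sub, BoxBall.weight_mult lam hN] at h
  rw [h, BoxBall.phi_eq_quad lam hN]
  simp only [BoxBall.vacancy_succ L lam hN, and_self]
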